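/- Let $k\ge 2$ and $1\le i\le k$ be integers. In the ring of formal power series in $q$ (over $\mathbb{C}$, or more generally over any field), $$\frac{\prod_{m\ge 1}(1-q^{2km})(1-q^{2km-k+i-1})(1-q^{2km-k-i+1})}{\prod_{m\ge 1}(1-q^m)}=\sum_{n\ge 0} b_{k,i}(n)\,q^n ,$$ where both infinite products converge coefficientwise and $b_{k,i}(n)$ denotes the number of partitions $\pi=(\pi_1\ge\pi_2\ge\dots\ge\pi_\ell\ge 1)$ of $n$ (of any length $\ell=\ell(\pi)\ge 0$) such that: 1. $\pi_t-\pi_{t+k-1}\ge 2$ for all $t\ge 1$ with $t+k-1\le \ell$; 2. at most $k-i$ of the parts of $\pi$ are equal to $1$; 3. for all $t\ge 1$ with $t+k-2\le \ell$: if $\pi_t-\pi_{t+k-2}\le 1$, then $\pi_t+\pi_{t+1}+\cdots+\pi_{t+k-2}\equiv i+k \pmod 2$. -/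

import Mathlib

open scoped PowerSeries.WithPiTopology

namespace AndrewsBressoud

open PowerSeries

noncomputable section

/-- The factor `1 - q ^ s` with `s = j + 1`; the product over `j : ℕ` is `(q)_∞`. -/
def qFactor (K : Type*) [Field K] (j : ℕ) : K⟦X⟧ :=
  1 - X ^ (j + 1)

/-- `(q)_∞ = ∏_{s ≥ 1} (1 - q ^ s)`. -/
def qInf (K : Type*) [Field K] [TopologicalSpace K] : K⟦X⟧ :=
  ∏' j : ℕ, qFactor K j

/-- The `m`-th factor, with `m = j + 1`,
`(1 - q ^ (2km)) (1 - q ^ (2km - k + i - 1)) (1 - q ^ (2km - k - i + 1))`.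
For `1 ≤ i ≤ k` and `m ≥ 1` none of the subtractions in the exponents truncates. -/
def numFactor (K : Type*) [Field K] (k i j : ℕ) : K⟦X⟧ :=
  (1 - X ^ (2 * k * (j + 1))) * (1 - X ^ (2 * k * (j + 1) - k + i - 1)) *
    (1 - X ^ (2 * k * (j + 1) - k - i + 1))

/-- The product `B_i`; the inverse is that of a formal power series with constant term `1`. -/
def B (K : Type*) [Field K] [TopologicalSpace K] (k i : ℕ) : K⟦X⟧ :=
  (∏' j : ℕ, numFactor K k i j) * (qInf K)⁻¹

end

/-- The parts of a partition as a nonincreasing list. -/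
def partList {n : ℕ} (p : n.Partition) : List ℕ :=
  p.parts.sort (· ≥ ·)

/-- The length (number of parts) of a partition. -/
def length {n : ℕ} (p : n.Partition) : ℕ :=
  (partList p).length

/-- `part p t` is the `t`-th largest part of `p`, counted from `t = 0`
(only ever used for `t < length p`). -/
def part {n : ℕ} (p : n.Partition) (t : ℕ) : ℕ :=
  (partList p).getD t 0

/-- The conditions on the partitions counted by `b_{k,i}(n)`. Differences of parts are written
additively, and each condition ranges over the indices for which all the parts in it exist. -/
structure IsAdmissible (k i : ℕ) {n : ℕ} (p : n.Partition) : Prop where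
  difference : ∀ t, t + (k - 1) < length p → part p (t + (k - 1)) + 2 ≤ part p t
  ones : p.parts.count 1 ≤ k - i
  parity : ∀ t, t + (k - 2) < length p → part p t ≤ part p (t + (k - 2)) + 1 →
    (∑ j ∈ Finset.range (k - 1), part p (t + j)) ≡ i + k [MOD 2]

/-- `b_{k,i}(n)`: the number of admissible partitions of `n`. -/
noncomputable def b (k i n : ℕ) : ℕ :=
  Nat.card {p : n.Partition // IsAdmissible k i p}

end AndrewsBressoud

/-!
Write `I = k - i + 1`. The proof compares two families of power series that satisfy the same
recursion in a shift parameter `s`, which plays the role of the substitution `x = q ^ s` in the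
usual two-variable generating functions; no second variable is needed.

On the combinatorial side, the conditions on a partition translate into conditions on the
multiplicities `f j` of its parts (`isAdmissible_iff`): `f j + f (j + 1) ≤ k - 1` for all `j`, with
a parity condition in the case of equality, and `f 1 < I`. Let `G I s` be the generating function
of the multisets of parts greater than `s` that satisfy these conditions, with `f (s + 1) < I` in
place of `f 1 < I` (`shiftedAdmissible`). Removing the parts equal to `s + 1` gives
`G I s = G (I - 2) s + (1 + q ^ (s + 1)) q ^ ((s + 1) (I - 2)) G (k - I + 1) (s + 1)` and
`G 1 s = G k (s + 1)` (`genFun_shiftedAdmissible_add_two`, `shiftedAdmissible_one`).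

On the analytic side, an explicit deformation `bSum` of a theta series satisfies the same recursion
(`bSum_add_two`, `bSum_one`), by telescoping. Modulo `q ^ N` both families, the first multiplied by
`(1 - q) ⋯ (1 - q ^ N)`, agree at `s = N`, hence by descent on `s` also at `s = 0`
(`qPoch_mul_genFun_eqMod_bSum`). There the second one is the theta series itself, which the Jacobi
triple product identity (`sum_thetaTerm_eqMod`) turns into the product of the `numFactor`s. That
identity is obtained from a finite form with Gaussian binomial coefficients, proved by induction
(`sum_thetaTerm_mul_centralGauss`).

Infinite sums are avoided throughout: all identities are proved for truncated sums and products
modulo an arbitrary power of `X`.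
-/

namespace AndrewsBressoud

open PowerSeries Finset

/-! ### Congruences modulo powers of `X` and infinite products -/

/-- Two power series agree up to (excluding) the coefficient of `X ^ N`. -/
def EqMod {K : Type*} [Field K] (N : ℕ) (a b : K⟦X⟧) : Prop :=
  X ^ N ∣ a - b

section EqMod

variable {K : Type*} [Field K] {N : ℕ} {a b c d : K⟦X⟧}

theorem EqMod.refl (N : ℕ) (a : K⟦X⟧) : EqMod N a a := by simp [EqMod]

theorem EqMod.symm (h : EqMod N a b) : EqMod N b a := by
  unfold EqMod at *
  exact (dvd_sub_comm).1 h

theorem EqMod.trans (h : EqMod N a b) (h' : EqMod N b c) : EqMod N a c := by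
  unfold EqMod at *
  simpa using dvd_add h h'

theorem EqMod.add (h : EqMod N a b) (h' : EqMod N c d) : EqMod N (a + c) (b + d) := by
  unfold EqMod at *
  convert dvd_add h h' using 1
  ring

theorem EqMod.mul (h : EqMod N a b) (h' : EqMod N c d) : EqMod N (a * c) (b * d) := by
  unfold EqMod at *
  convert dvd_add (h.mul_right c) (h'.mul_left b) using 1
  ring

theorem EqMod.mul_left (c : K⟦X⟧) (h : EqMod N a b) : EqMod N (c * a) (c * b) :=
  (EqMod.refl N c).mul h

theorem EqMod.mono {M : ℕ} (hM : M ≤ N) (h : EqMod N a b) : EqMod M a b :=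
  (pow_dvd_pow X hM).trans h

theorem EqMod.coeff_eq (h : EqMod N a b) {n : ℕ} (hn : n < N) : coeff n a = coeff n b := by
  have := (X_pow_dvd_iff.1 h) n hn
  rwa [map_sub, sub_eq_zero] at this

theorem eqMod_iff_coeff : EqMod N a b ↔ ∀ n < N, coeff n a = coeff n b :=
  ⟨fun h _ hn => h.coeff_eq hn, fun h => X_pow_dvd_iff.2 fun n hn => by
    rw [map_sub, h n hn, sub_self]⟩

theorem eq_of_forall_eqMod (h : ∀ N, EqMod N a b) : a = b := by
  ext n
  exact (h (n + 1)).coeff_eq (Nat.lt_succ_self n)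

theorem EqMod.of_mul_left (hc : constantCoeff c ≠ 0) (h : EqMod N (c * a) (c * b)) :
    EqMod N a b := by
  have := h.mul_left c⁻¹
  rwa [← mul_assoc, ← mul_assoc, PowerSeries.inv_mul_cancel _ hc, one_mul, one_mul] at this

theorem EqMod.sum {ι : Type*} {s : Finset ι} {f g : ι → K⟦X⟧}
    (h : ∀ j ∈ s, EqMod N (f j) (g j)) : EqMod N (∑ j ∈ s, f j) (∑ j ∈ s, g j) := by
  unfold EqMod
  rw [← Finset.sum_sub_distrib]
  exact Finset.dvd_sum h

theorem EqMod.prod_eq_one {ι : Type*} {s : Finset ι} {f : ι → K⟦X⟧}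
    (h : ∀ j ∈ s, EqMod N (f j) 1) : EqMod N (∏ j ∈ s, f j) 1 := by
  classical
  induction s using Finset.induction_on with
  | empty => exact EqMod.refl N 1
  | insert j s hj ih =>
    rw [Finset.prod_insert hj, ← one_mul (1 : K⟦X⟧)]
    exact (h j (Finset.mem_insert_self j s)).mul
      (ih fun l hl => h l (Finset.mem_insert_of_mem hl))

theorem eqMod_one_sub_X_pow {e : ℕ} (h : N ≤ e) : EqMod N (1 - X ^ e : K⟦X⟧) 1 := by
  unfold EqMod
  rw [sub_sub_cancel_left, dvd_neg]
  exact pow_dvd_pow X h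

theorem eqMod_prod_of_subset {f : ℕ → K⟦X⟧} (hf : ∀ j, EqMod (j + 1) (f j) 1) {s : Finset ℕ}
    (hs : range N ⊆ s) : EqMod N (∏ j ∈ s, f j) (∏ j ∈ range N, f j) := by
  rw [← Finset.prod_sdiff hs]
  conv => enter [3]; rw [← one_mul (∏ j ∈ range N, f j)]
  refine (EqMod.prod_eq_one fun j hj => (hf j).mono ?_).mul (EqMod.refl N _)
  have := (Finset.mem_sdiff.1 hj).2
  rw [Finset.mem_range] at this
  lia

variable [TopologicalSpace K]

/-- Coefficientwise convergence is by stabilisation, so no compatibility of the topology of `K`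
with its field structure is needed. -/
theorem hasProd_of_eqMod_one {f : ℕ → K⟦X⟧} (hf : ∀ j, EqMod (j + 1) (f j) 1) :
    HasProd f (PowerSeries.mk fun n => coeff n (∏ j ∈ range (n + 1), f j)) := by
  unfold HasProd
  rw [PowerSeries.WithPiTopology.tendsto_iff_coeff_tendsto]
  intro n
  refine tendsto_const_nhds.congr' ?_
  refine (Filter.eventually_ge_atTop (range (n + 1))).mono fun s hs => ?_
  rw [coeff_mk]
  exact ((eqMod_prod_of_subset hf hs).coeff_eq (Nat.lt_succ_self n)).symm

theorem tprod_eqMod_prod_range [T2Space K] {f : ℕ → K⟦X⟧} (hf : ∀ j, EqMod (j + 1) (f j) 1)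
    (N : ℕ) : EqMod N (∏' j, f j) (∏ j ∈ range N, f j) := by
  rw [(hasProd_of_eqMod_one hf).tprod_eq, eqMod_iff_coeff]
  intro n hn
  rw [coeff_mk]
  refine ((eqMod_prod_of_subset hf ?_).coeff_eq (Nat.lt_succ_self n)).symm
  exact Finset.range_subset_range.2 hn

end EqMod

/-! ### A finite form of the Jacobi triple product identity -/

section JacobiTripleProduct

variable (K : Type*) [Field K]

/-- The finite product `(1 - X ^ e) (1 - X ^ (2 * e)) ⋯ (1 - X ^ (n * e))`. -/
noncomputable def qPoch (e n : ℕ) : K⟦X⟧ :=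
  ∏ j ∈ range n, (1 - X ^ (e * (j + 1)))

theorem qPoch_succ (e n : ℕ) : qPoch K e (n + 1) = qPoch K e n * (1 - X ^ (e * (n + 1))) :=
  Finset.prod_range_succ _ _

theorem constantCoeff_qPoch {e : ℕ} (he : 0 < e) (n : ℕ) : constantCoeff (qPoch K e n) = 1 := by
  rw [qPoch, map_prod]
  refine Finset.prod_eq_one fun j _ => ?_
  have : e * (j + 1) ≠ 0 := by positivity
  simp [this]

theorem qPoch_ne_zero {e : ℕ} (he : 0 < e) (n : ℕ) : qPoch K e n ≠ 0 := by
  intro h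
  have := constantCoeff_qPoch K he n
  simp [h] at this

theorem one_sub_X_pow_mul_eqMod_one (e : ℕ) (he : 0 < e) (j : ℕ) :
    EqMod (j + 1) (1 - X ^ (e * (j + 1)) : K⟦X⟧) 1 :=
  eqMod_one_sub_X_pow (Nat.le_mul_of_pos_left _ he)

theorem qPoch_eqMod {e : ℕ} (he : 0 < e) {N n : ℕ} (h : N ≤ n) :
    EqMod N (qPoch K e n) (qPoch K e N) :=
  eqMod_prod_of_subset (one_sub_X_pow_mul_eqMod_one K e he) (Finset.range_subset_range.2 h)

/-- The Gaussian binomial coefficient `[2N+1, N-n]` in the variable `X ^ e`. -/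
noncomputable def centralGauss (e N n : ℕ) : K⟦X⟧ :=
  if n ≤ N then qPoch K e (2 * N + 1) * (qPoch K e (N - n) * qPoch K e (N + n + 1))⁻¹ else 0

theorem centralGauss_mul {e : ℕ} (he : 0 < e) (m n : ℕ) :
    centralGauss K e (n + m) n * (qPoch K e m * qPoch K e (2 * n + m + 1)) =
      qPoch K e (2 * (n + m) + 1) := by
  rw [centralGauss, if_pos (by lia), mul_assoc, show n + m - n = m by lia,
    show n + m + n + 1 = 2 * n + m + 1 by ring, PowerSeries.inv_mul_cancel, mul_one]
  simp [constantCoeff_qPoch K he]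

theorem centralGauss_of_lt {e N n : ℕ} (h : N < n) : centralGauss K e N n = 0 :=
  if_neg (by lia)

theorem centralGauss_self {e : ℕ} (he : 0 < e) (n : ℕ) : centralGauss K e n n = 1 := by
  have := centralGauss_mul K he 0 n
  rw [add_zero, add_zero, show qPoch K e 0 = 1 from Finset.prod_range_zero _, one_mul] at this
  refine mul_right_cancel₀ (qPoch_ne_zero K he (2 * n + 1)) ?_
  rw [one_mul, this]

/-- The two-step Pascal rule for `[2N+1, N-n]`, here with `N = n + 1 + m` and `n + 1` for `n`. -/
theorem centralGauss_succ_succ {e : ℕ} (he : 0 < e) (m n : ℕ) :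
    centralGauss K e (n + 1 + m + 1) (n + 1) =
      (1 + X ^ (e * (2 * (n + 1 + m) + 2))) * centralGauss K e (n + 1 + m) (n + 1) +
      X ^ (e * (m + 1)) * centralGauss K e (n + 1 + m) n +
      X ^ (e * (2 * n + m + 4)) * centralGauss K e (n + 1 + m) (n + 2) := by
  have h1 := centralGauss_mul K he (m + 1) (n + 1)
  have h2 := centralGauss_mul K he m (n + 1)
  have h3 := centralGauss_mul K he (m + 1) n
  have h4 : centralGauss K e (n + 1 + m) (n + 2) *
      (qPoch K e m * qPoch K e (2 * n + m + 4)) =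
      (1 - X ^ (e * m)) * qPoch K e (2 * (n + 1 + m) + 1) := by
    rcases m with _ | m
    · simp [centralGauss_of_lt]
    · have := centralGauss_mul K he m (n + 2)
      rw [show n + 1 + (m + 1) = n + 2 + m by ring, ← this, qPoch_succ K e m,
        show 2 * n + (m + 1) + 4 = 2 * (n + 2) + m + 1 by ring]
      ring
  rw [show n + 1 + (m + 1) = n + 1 + m + 1 by ring] at h1
  rw [show n + (m + 1) = n + 1 + m by ring] at h3
  have hne : qPoch K e (m + 1) * qPoch K e (2 * n + m + 4) ≠ 0 :=
    mul_ne_zero (qPoch_ne_zero K he _) (qPoch_ne_zero K he _)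
  refine mul_right_cancel₀ hne ?_
  rw [show 2 * (n + 1) + (m + 1) + 1 = 2 * n + m + 4 by ring,
    show 2 * (n + 1 + m + 1) + 1 = 2 * (n + 1 + m) + 1 + 1 + 1 by ring,
    qPoch_succ K e (2 * (n + 1 + m) + 1 + 1), qPoch_succ K e (2 * (n + 1 + m) + 1)] at h1
  rw [show 2 * (n + 1) + m + 1 = 2 * n + m + 3 by ring] at h2
  rw [show 2 * n + (m + 1) + 1 = 2 * n + m + 2 by ring] at h3
  rw [h1]
  have e1 : qPoch K e (m + 1) = qPoch K e m * (1 - X ^ (e * (m + 1))) := qPoch_succ K e m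
  have e2 : qPoch K e (2 * n + m + 4) =
      qPoch K e (2 * n + m + 3) * (1 - X ^ (e * (2 * n + m + 4))) := qPoch_succ K e _
  have e3 : qPoch K e (2 * n + m + 3) =
      qPoch K e (2 * n + m + 2) * (1 - X ^ (e * (2 * n + m + 3))) := qPoch_succ K e _
  have t1 : (1 + X ^ (e * (2 * (n + 1 + m) + 2))) * centralGauss K e (n + 1 + m) (n + 1) *
      (qPoch K e (m + 1) * qPoch K e (2 * n + m + 4)) =
      (1 + X ^ (e * (2 * (n + 1 + m) + 2))) * (1 - X ^ (e * (m + 1))) *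
        (1 - X ^ (e * (2 * n + m + 4))) * qPoch K e (2 * (n + 1 + m) + 1) := by
    rw [← h2, e1, e2]; ring
  have t2 : X ^ (e * (m + 1)) * centralGauss K e (n + 1 + m) n *
      (qPoch K e (m + 1) * qPoch K e (2 * n + m + 4)) =
      X ^ (e * (m + 1)) * (1 - X ^ (e * (2 * n + m + 3))) *
        (1 - X ^ (e * (2 * n + m + 4))) * qPoch K e (2 * (n + 1 + m) + 1) := by
    rw [← h3, e2, e3]; ring
  have t3 : X ^ (e * (2 * n + m + 4)) * centralGauss K e (n + 1 + m) (n + 2) *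
      (qPoch K e (m + 1) * qPoch K e (2 * n + m + 4)) =
      X ^ (e * (2 * n + m + 4)) * (1 - X ^ (e * (m + 1))) * (1 - X ^ (e * m)) *
        qPoch K e (2 * (n + 1 + m) + 1) := by
    rw [e1]; linear_combination X ^ (e * (2 * n + m + 4)) * (1 - X ^ (e * (m + 1))) * h4
  rw [add_mul, add_mul, t1, t2, t3]
  ring

theorem centralGauss_succ_succ_of_le {e : ℕ} (he : 0 < e) {N n : ℕ} (h : n ≤ N) :
    centralGauss K e (N + 1) (n + 1) =
      (1 + X ^ (e * (2 * N + 2))) * centralGauss K e N (n + 1) +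
      X ^ (e * (N - n)) * centralGauss K e N n +
      X ^ (e * (N + n + 3)) * centralGauss K e N (n + 2) := by
  rcases h.eq_or_lt with rfl | h
  · simp [centralGauss_self K he, centralGauss_of_lt]
  · obtain ⟨m, rfl⟩ := Nat.exists_eq_add_of_le (show n + 1 ≤ N from h)
    rw [centralGauss_succ_succ K he, show n + 1 + m - n = m + 1 by lia,
      show n + 1 + m + n + 3 = 2 * n + m + 4 by ring]

/-- The boundary case `n = 0` of the two-step Pascal rule, where `[2N+1, N+1] = [2N+1, N]`. -/
theorem centralGauss_succ_zero {e : ℕ} (he : 0 < e) (N : ℕ) :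
    centralGauss K e (N + 1) 0 =
      (1 + X ^ (e * (2 * N + 2))) * centralGauss K e N 0 +
      X ^ (e * (N + 1)) * centralGauss K e N 0 +
      X ^ (e * (N + 2)) * centralGauss K e N 1 := by
  have h1 := centralGauss_mul K he (N + 1) 0
  have h2 := centralGauss_mul K he N 0
  have h4 : centralGauss K e N 1 * (qPoch K e N * qPoch K e (N + 2)) =
      (1 - X ^ (e * N)) * qPoch K e (2 * N + 1) := by
    rcases N with _ | m
    · simp [centralGauss_of_lt]
    · have := centralGauss_mul K he m 1
      rw [show 1 + m = m + 1 by ring] at this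
      rw [← this, qPoch_succ K e m, show m + 1 + 2 = 2 * 1 + m + 1 by ring]
      ring
  simp only [zero_add, mul_zero] at h1 h2
  have hne : qPoch K e (N + 1) * qPoch K e (N + 2) ≠ 0 :=
    mul_ne_zero (qPoch_ne_zero K he _) (qPoch_ne_zero K he _)
  refine mul_right_cancel₀ hne ?_
  rw [show 2 * (N + 1) + 1 = 2 * N + 1 + 1 + 1 by ring, qPoch_succ K e (2 * N + 1 + 1),
    qPoch_succ K e (2 * N + 1)] at h1
  rw [show N + 1 + 1 = N + 2 by ring] at h1
  rw [h1]
  have e1 : qPoch K e (N + 1) = qPoch K e N * (1 - X ^ (e * (N + 1))) := qPoch_succ K e N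
  have e2 : qPoch K e (N + 2) =
      qPoch K e (N + 1) * (1 - X ^ (e * (N + 2))) := qPoch_succ K e _
  have t1 : centralGauss K e N 0 * (qPoch K e (N + 1) * qPoch K e (N + 2)) =
      (1 - X ^ (e * (N + 1))) * (1 - X ^ (e * (N + 2))) * qPoch K e (2 * N + 1) := by
    rw [← h2, e2, e1]; ring
  have t3 : centralGauss K e N 1 * (qPoch K e (N + 1) * qPoch K e (N + 2)) =
      (1 - X ^ (e * (N + 1))) * (1 - X ^ (e * N)) * qPoch K e (2 * N + 1) := by
    rw [e1]; linear_combination (1 - X ^ (e * (N + 1))) * h4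
  linear_combination (-(1 + X ^ (e * (2 * N + 2))) - X ^ (e * (N + 1))) * t1 -
    X ^ (e * (N + 2)) * t3

/-- The theta series `∑ n, (-1) ^ n X ^ (k n ^ 2 + d n)` over all integers `n`, with `k = i + d`,
has as its `n`-th term here the sum of the terms with indices `n` and `-n - 1`. -/
noncomputable def thetaTerm (i d n : ℕ) : K⟦X⟧ :=
  (-1) ^ n * X ^ (n * ((i + d) * n + d)) * (1 - X ^ ((2 * n + 1) * i))

theorem thetaTerm_succ_mul (i d m n : ℕ) :
    thetaTerm K i d (n + 1) * ((1 - X ^ (2 * (i + d) * (n + 1 + m + 1) + i)) *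
      (1 - X ^ (2 * (i + d) * (n + 1 + m) + i + 2 * d))) =
      (1 + X ^ (2 * (i + d) * (2 * (n + 1 + m) + 2))) * thetaTerm K i d (n + 1) +
      X ^ (2 * (i + d) * (2 * n + m + 3)) * thetaTerm K i d n +
      X ^ (2 * (i + d) * m) * thetaTerm K i d (n + 2) := by
  unfold thetaTerm
  ring

theorem thetaTerm_zero_mul (i d N : ℕ) :
    thetaTerm K i d 0 * ((1 - X ^ (2 * (i + d) * (N + 1) + i)) *
      (1 - X ^ (2 * (i + d) * N + i + 2 * d))) =
      (1 + X ^ (2 * (i + d) * (2 * N + 2))) * thetaTerm K i d 0 +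
      X ^ (2 * (i + d) * (N + 1)) * thetaTerm K i d 0 +
      X ^ (2 * (i + d) * N) * thetaTerm K i d 1 := by
  unfold thetaTerm
  ring

/-- The finite Jacobi triple product: with `q = X ^ (2 (i + d))` and `z = X ^ i` it is the expansion
of `(1 - z) (1 - z q) ⋯ (1 - z q ^ N) (1 - q / z) ⋯ (1 - q ^ N / z)`. -/
theorem sum_thetaTerm_mul_centralGauss (i d : ℕ) (hi : 0 < i) (N : ℕ) :
    ∑ n ∈ range (N + 1), centralGauss K (2 * (i + d)) N n * thetaTerm K i d n =
      (1 - X ^ i) * ∏ j ∈ range N, ((1 - X ^ (2 * (i + d) * (j + 1) + i)) *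
        (1 - X ^ (2 * (i + d) * j + i + 2 * d))) := by
  have he : 0 < 2 * (i + d) := by lia
  induction N with
  | zero => simp [thetaTerm, centralGauss_self K he]
  | succ N ih =>
    rw [Finset.prod_range_succ, ← mul_assoc, ← ih]
    clear ih
    set F : K⟦X⟧ := (1 - X ^ (2 * (i + d) * (N + 1) + i)) *
      (1 - X ^ (2 * (i + d) * N + i + 2 * d)) with hF
    have hA : ∀ n ∈ range (N + 1),
        centralGauss K (2 * (i + d)) N (n + 1) * thetaTerm K i d (n + 1) * F =
        (1 + X ^ (2 * (i + d) * (2 * N + 2))) *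
          (centralGauss K (2 * (i + d)) N (n + 1) * thetaTerm K i d (n + 1)) +
        X ^ (2 * (i + d) * (N + n + 2)) * centralGauss K (2 * (i + d)) N (n + 1) *
          thetaTerm K i d n +
        X ^ (2 * (i + d) * (N - (n + 1))) * centralGauss K (2 * (i + d)) N (n + 1) *
          thetaTerm K i d (n + 2) := by
      intro n hn
      rcases (Nat.lt_succ_iff.1 (Finset.mem_range.1 hn)).eq_or_lt with rfl | h
      · simp [centralGauss_of_lt]
      · obtain ⟨m, rfl⟩ := Nat.exists_eq_add_of_le (show n + 1 ≤ N from h)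
        have := thetaTerm_succ_mul K i d m n
        rw [show n + 1 + m - (n + 1) = m by lia, show n + 1 + m + n + 2 = 2 * n + m + 3 by ring]
        linear_combination centralGauss K (2 * (i + d)) (n + 1 + m) (n + 1) * this
    have hB : ∀ n ∈ range (N + 1),
        centralGauss K (2 * (i + d)) (N + 1) (n + 1) * thetaTerm K i d (n + 1) =
        (1 + X ^ (2 * (i + d) * (2 * N + 2))) *
          (centralGauss K (2 * (i + d)) N (n + 1) * thetaTerm K i d (n + 1)) +
        X ^ (2 * (i + d) * (N - n)) * centralGauss K (2 * (i + d)) N n *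
          thetaTerm K i d (n + 1) +
        X ^ (2 * (i + d) * (N + (n + 1) + 2)) * centralGauss K (2 * (i + d)) N (n + 1 + 1) *
          thetaTerm K i d (n + 1) := by
      intro n hn
      rw [centralGauss_succ_succ_of_le K he (Nat.lt_succ_iff.1 (Finset.mem_range.1 hn))]
      ring
    have hz : ∑ n ∈ range (N + 1), centralGauss K (2 * (i + d)) N n * thetaTerm K i d n =
        ∑ n ∈ range (N + 1 + 1), centralGauss K (2 * (i + d)) N n * thetaTerm K i d n := by
      rw [Finset.sum_range_succ _ (N + 1), centralGauss_of_lt K (Nat.lt_succ_self N)]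
      ring
    -- The two shifted sums, each extended by a vanishing term at its upper end.
    have s1 := Finset.sum_range_succ' (fun n => X ^ (2 * (i + d) * (N + n + 2)) *
      centralGauss K (2 * (i + d)) N (n + 1) * thetaTerm K i d n) (N + 1)
    rw [Finset.sum_range_succ, centralGauss_of_lt K (show N < N + 1 + 1 by lia)] at s1
    have s2 := Finset.sum_range_succ' (fun n => X ^ (2 * (i + d) * (N - n)) *
      centralGauss K (2 * (i + d)) N n * thetaTerm K i d (n + 1)) (N + 1)
    rw [Finset.sum_range_succ, centralGauss_of_lt K (show N < N + 1 by lia)] at s2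
    rw [hz, Finset.sum_range_succ' _ (N + 1), Finset.sum_range_succ' _ (N + 1),
      Finset.sum_congr rfl hB, add_mul, Finset.sum_mul, Finset.sum_congr rfl hA]
    simp only [Finset.sum_add_distrib, ← Finset.mul_sum]
    have h0 := thetaTerm_zero_mul K i d N
    rw [← hF] at h0
    rw [centralGauss_succ_zero K he]
    simp only [add_zero, zero_add, Nat.sub_zero, mul_zero, zero_mul] at s1 s2
    linear_combination s2 - s1 - centralGauss K (2 * (i + d)) N 0 * h0

theorem centralGauss_mul_qPoch_eqMod {e : ℕ} (he : 0 < e) {N n : ℕ} (hn : n ≤ N) :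
    EqMod N (qPoch K e N * centralGauss K e (2 * N) n) 1 := by
  obtain ⟨m, hm⟩ := Nat.exists_eq_add_of_le (show n ≤ 2 * N by lia)
  have h := centralGauss_mul K he m n
  rw [← hm] at h
  have h1 : EqMod N (centralGauss K e (2 * N) n * (qPoch K e m * qPoch K e (2 * n + m + 1)))
      (centralGauss K e (2 * N) n * (qPoch K e N * qPoch K e N)) :=
    ((qPoch_eqMod K he (by lia)).mul (qPoch_eqMod K he (by lia))).mul_left _
  rw [h] at h1
  have h2 := h1.symm.trans (qPoch_eqMod K he (show N ≤ 2 * (2 * N) + 1 by lia))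
  refine EqMod.of_mul_left (c := qPoch K e N) (by simp [constantCoeff_qPoch K he]) ?_
  convert h2 using 1 <;> ring

theorem thetaTerm_eqMod_zero {i d n N : ℕ} (hi : 0 < i) (h : N ≤ n) :
    EqMod N (thetaTerm K i d n) 0 := by
  unfold EqMod thetaTerm
  rw [sub_zero]
  refine Dvd.dvd.mul_right (Dvd.dvd.mul_left (pow_dvd_pow X ?_) _) _
  nlinarith [Nat.zero_le (n * d), Nat.zero_le (d * n * n), Nat.mul_le_mul hi (Nat.le_refl (n * n)),
    Nat.le_mul_self n]

/-- The Jacobi triple product identity, truncated. -/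
theorem sum_thetaTerm_eqMod (i d : ℕ) (hi : 0 < i) (N : ℕ) :
    EqMod N (∑ n ∈ range N, thetaTerm K i d n)
      (∏ j ∈ range N, ((1 - X ^ (2 * (i + d) * (j + 1))) *
        (1 - X ^ (2 * (i + d) * j + i + 2 * d)) * (1 - X ^ (2 * (i + d) * j + i)))) := by
  have he : 0 < 2 * (i + d) := by lia
  have hle : ∀ j, j ≤ 2 * (i + d) * j := fun j => Nat.le_mul_of_pos_left j he
  have hl : EqMod N (qPoch K (2 * (i + d)) N * ∑ n ∈ range (2 * N + 1),
      centralGauss K (2 * (i + d)) (2 * N) n * thetaTerm K i d n)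
      (∑ n ∈ range N, thetaTerm K i d n) := by
    -- Terms with index at least `N` vanish modulo `X ^ N`, so only `[4N+1, 2N-n]` with `n < N` is
    -- needed, which has stabilised modulo `X ^ N`.
    rw [show 2 * N + 1 = N + (N + 1) by ring, Finset.sum_range_add, mul_add, Finset.mul_sum,
      Finset.mul_sum, ← add_zero (∑ n ∈ range N, thetaTerm K i d n)]
    refine EqMod.add (EqMod.sum fun n hn => ?_) ?_
    · rw [← mul_assoc]
      conv => enter [3]; rw [← one_mul (thetaTerm K i d n)]
      exact (centralGauss_mul_qPoch_eqMod K he (Finset.mem_range.1 hn).le).mul (EqMod.refl N _)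
    · conv => enter [3]; rw [← Finset.sum_const_zero (s := range (N + 1))]
      refine EqMod.sum fun n _ => ?_
      rw [← mul_assoc]
      conv => enter [3]; rw [← mul_zero (qPoch K (2 * (i + d)) N *
        centralGauss K (2 * (i + d)) (2 * N) (N + n))]
      exact (thetaTerm_eqMod_zero K hi (Nat.le_add_right N n)).mul_left _
  rw [sum_thetaTerm_mul_centralGauss K i d hi] at hl
  refine hl.symm.trans ?_
  have hp : (1 - X ^ i : K⟦X⟧) * ∏ j ∈ range (2 * N), (1 - X ^ (2 * (i + d) * (j + 1) + i)) =
      ∏ j ∈ range (2 * N + 1), (1 - X ^ (2 * (i + d) * j + i)) := by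
    rw [Finset.prod_range_succ']
    simp [mul_comm]
  have hr : qPoch K (2 * (i + d)) N * ((1 - X ^ i) * ∏ j ∈ range (2 * N),
      ((1 - X ^ (2 * (i + d) * (j + 1) + i)) * (1 - X ^ (2 * (i + d) * j + i + 2 * d)))) =
      qPoch K (2 * (i + d)) N * (∏ j ∈ range (2 * N), (1 - X ^ (2 * (i + d) * j + i + 2 * d))) *
      ∏ j ∈ range (2 * N + 1), (1 - X ^ (2 * (i + d) * j + i)) := by
    rw [Finset.prod_mul_distrib, ← hp]
    ring
  rw [hr, Finset.prod_mul_distrib, Finset.prod_mul_distrib]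
  refine ((EqMod.refl N _).mul (eqMod_prod_of_subset (fun j => eqMod_one_sub_X_pow ?_) ?_)).mul
    (eqMod_prod_of_subset (fun j => eqMod_one_sub_X_pow ?_) ?_)
  · have := hle j; lia
  · exact Finset.range_subset_range.2 (by lia)
  · have := hle j; lia
  · exact Finset.range_subset_range.2 (by lia)

end JacobiTripleProduct

/-! ### The series solving the functional equations -/

section ThetaSum

variable (K : Type*) [Field K]

/-- The Gaussian binomial coefficient `[s+n, n]` in the variable `X ^ 2`. -/
noncomputable def gaussSq (s n : ℕ) : K⟦X⟧ :=
  (∏ j ∈ range n, (1 - X ^ (2 * (s + j + 1)))) * (qPoch K 2 n)⁻¹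

theorem gaussSq_zero_right (s : ℕ) : gaussSq K s 0 = 1 := by
  simp [gaussSq, qPoch]

theorem gaussSq_mul_qPoch (s n : ℕ) :
    gaussSq K s n * qPoch K 2 n = ∏ j ∈ range n, (1 - X ^ (2 * (s + j + 1))) := by
  rw [gaussSq, mul_assoc, PowerSeries.inv_mul_cancel, mul_one]
  simp [constantCoeff_qPoch K two_pos]

theorem gaussSq_zero_left (n : ℕ) : gaussSq K 0 n = 1 := by
  refine mul_right_cancel₀ (qPoch_ne_zero K two_pos n) ?_
  rw [gaussSq_mul_qPoch, one_mul, qPoch]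
  simp

theorem gaussSq_succ_mul (s n : ℕ) :
    gaussSq K s (n + 1) * (1 - X ^ (2 * (n + 1))) =
      gaussSq K s n * (1 - X ^ (2 * (s + n + 1))) := by
  refine mul_right_cancel₀ (qPoch_ne_zero K two_pos n) ?_
  have h1 := gaussSq_mul_qPoch K s (n + 1)
  have h2 := gaussSq_mul_qPoch K s n
  rw [Finset.prod_range_succ, ← h2, qPoch_succ] at h1
  linear_combination h1

theorem gaussSq_mul_shift (s n : ℕ) :
    gaussSq K s n * (1 - X ^ (2 * (s + n + 1))) =
      (1 - X ^ (2 * (s + 1))) * gaussSq K (s + 1) n := by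
  refine mul_right_cancel₀ (qPoch_ne_zero K two_pos n) ?_
  have h1 := gaussSq_mul_qPoch K s n
  have h2 := gaussSq_mul_qPoch K (s + 1) n
  have h3 : (∏ j ∈ range n, (1 - X ^ (2 * (s + j + 1)) : K⟦X⟧)) * (1 - X ^ (2 * (s + n + 1))) =
      (∏ j ∈ range n, (1 - X ^ (2 * (s + 1 + j + 1)))) * (1 - X ^ (2 * (s + 1))) := by
    rw [← Finset.prod_range_succ (fun j => (1 - X ^ (2 * (s + j + 1)) : K⟦X⟧)),
      Finset.prod_range_succ']
    simp only [add_zero]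
    congr 1
    refine Finset.prod_congr rfl fun j _ => ?_
    ring
  linear_combination (1 - X ^ (2 * (s + n + 1))) * h1 + h3 - (1 - X ^ (2 * (s + 1))) * h2

/-- The `n`-th term, at `x = X ^ s`, of
`∑ n, (-1) ^ n x ^ ((k-1) n) q ^ (k n (n+1) - i n) (1 - x ^ i q ^ ((2n+1) i)) [s+n, n]_{q ^ 2}`,
a deformation of the theta series of `thetaTerm`. -/
noncomputable def bTerm (k i s n : ℕ) : K⟦X⟧ :=
  (-1) ^ n * X ^ (n * (s * (k - 1) + k * n + (k - i))) * (1 - X ^ ((s + 2 * n + 1) * i)) *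
    gaussSq K s n

/-- The partial sum of the terms `bTerm` with index below `M`, multiplied by
`(1 - q) ⋯ (1 - q ^ s)`. -/
noncomputable def bSum (M k i s : ℕ) : K⟦X⟧ :=
  qPoch K 1 s * ∑ n ∈ range M, bTerm K k i s n

theorem bTerm_zero_left (i d n : ℕ) : bTerm K (i + d) i 0 n = thetaTerm K i d n := by
  rw [bTerm, thetaTerm, gaussSq_zero_left, Nat.add_sub_cancel_left]
  ring

theorem bSum_zero_index (M k s : ℕ) : bSum K M k 0 s = 0 := by
  simp [bSum, bTerm]

/-- A sum telescopes modulo `X ^ M` if the terms `A n` shifted by one index combine with `B n`. -/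
theorem sum_add_eqMod_of_shift {M : ℕ} {A B C : ℕ → K⟦X⟧} (h0 : A 0 = 0) (hM : EqMod M (A M) 0)
    (h : ∀ n, A (n + 1) + B n = C n) :
    EqMod M (∑ n ∈ range M, (A n + B n)) (∑ n ∈ range M, C n) := by
  have e : ∑ n ∈ range M, C n = ∑ n ∈ range M, (A n + B n) + A M := by
    have := (Finset.sum_range_succ' A M).symm.trans (Finset.sum_range_succ A M)
    rw [h0, add_zero] at this
    simp only [← h, Finset.sum_add_distrib]
    rw [this]
    ring
  unfold EqMod at *
  rw [e, sub_add_cancel_left, dvd_neg]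
  simpa using hM

theorem X_pow_mul_eqMod_zero {M e : ℕ} (h : M ≤ e) (u v : K⟦X⟧) :
    EqMod M (u * X ^ e * v) 0 := by
  unfold EqMod
  rw [sub_zero]
  exact Dvd.dvd.mul_right (Dvd.dvd.mul_left (pow_dvd_pow X h) _) _

/-- The difference of the terms for `j + 2` and `j` splits into `A n`, with a factor
`1 - X ^ (2 n)`, and `B n`, with a factor `1 - X ^ (2 (s + n + 1))`. These factors shift the
Gaussian binomial coefficients so that `A (n + 1) + B n` is a term of the sum at `s + 1`. -/
theorem bSum_add_two (M j d s : ℕ) :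
    EqMod M (bSum K M (j + 2 + d) (j + 2) s)
      (bSum K M (j + 2 + d) j s +
        (1 + X ^ (s + 1)) * X ^ ((s + 1) * j) * bSum K M (j + 2 + d) (d + 1) (s + 1)) := by
  have key := sum_add_eqMod_of_shift K (M := M)
    (A := fun n => (-1) ^ n * X ^ (n * (s * (j + 1 + d) + (j + 2 + d) * n + d)) *
      (gaussSq K s n * (1 - X ^ (2 * n))))
    (B := fun n => (-1) ^ n * X ^ (n * (s * (j + 1 + d) + (j + 2 + d) * n + d + 2) +
      (s + 2 * n + 1) * j) * (gaussSq K s n * (1 - X ^ (2 * (s + n + 1)))))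
    (C := fun n => (1 - X ^ (2 * (s + 1))) * X ^ ((s + 1) * j) *
      bTerm K (j + 2 + d) (d + 1) (s + 1) n)
    (by simp) (X_pow_mul_eqMod_zero K (by
      rcases M.eq_zero_or_pos with rfl | hM
      · simp
      · nlinarith [Nat.zero_le (M * (s * (j + 1 + d))), Nat.zero_le (j * M * M),
          Nat.zero_le (d * M * M), Nat.zero_le (M * d), Nat.le_mul_self M]) _ _)
    (fun n => by
      rw [gaussSq_succ_mul, gaussSq_mul_shift, bTerm, show j + 2 + d - 1 = j + 1 + d by lia,
        show j + 2 + d - (d + 1) = j + 1 by lia]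
      ring)
  have hl : ∀ n, bTerm K (j + 2 + d) (j + 2) s n =
      bTerm K (j + 2 + d) j s n +
      ((-1) ^ n * X ^ (n * (s * (j + 1 + d) + (j + 2 + d) * n + d)) *
      (gaussSq K s n * (1 - X ^ (2 * n))) +
      (-1) ^ n * X ^ (n * (s * (j + 1 + d) + (j + 2 + d) * n + d + 2) +
      (s + 2 * n + 1) * j) * (gaussSq K s n * (1 - X ^ (2 * (s + n + 1))))) := by
    intro n
    rw [bTerm, bTerm, show j + 2 + d - 1 = j + 1 + d by lia,
        show j + 2 + d - (j + 2) = d by lia, show j + 2 + d - j = d + 2 by lia]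
    ring
  unfold bSum
  rw [Finset.sum_congr rfl fun n _ => hl n, Finset.sum_add_distrib, mul_add]
  refine (EqMod.refl M _).add ?_
  convert key.mul_left (qPoch K 1 s) using 1
  rw [← Finset.mul_sum, qPoch_succ]
  ring

/-- The telescoping works after multiplication by the unit `1 + X ^ (s + 1)`. -/
theorem bSum_one (M d s : ℕ) :
    EqMod M (bSum K M (d + 1) 1 s) (bSum K M (d + 1) (d + 1) (s + 1)) := by
  have key := sum_add_eqMod_of_shift K (M := M)
    (A := fun n => (-1) ^ n * X ^ (n * ((s + 1) * d + (d + 1) * n) + s + 1) *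
      (gaussSq K s n * (1 - X ^ (2 * n))))
    (B := fun n => (-1) ^ n * X ^ (n * ((s + 1) * d + (d + 1) * n) + (s + 2 * n + 2) * (d + 1)) *
      (gaussSq K s n * (1 - X ^ (2 * (s + n + 1)))))
    (C := fun n => 0)
    (by simp) (X_pow_mul_eqMod_zero K (by
      nlinarith [Nat.zero_le (M * ((s + 1) * d)), Nat.zero_le (d * M * M), Nat.le_mul_self M]) _ _)
    (fun n => by
      rw [gaussSq_succ_mul]
      ring)
  have hl : ∀ n, (1 + X ^ (s + 1)) * bTerm K (d + 1) 1 s n =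
      (1 - X ^ (2 * (s + 1))) * bTerm K (d + 1) (d + 1) (s + 1) n +
      ((-1) ^ n * X ^ (n * ((s + 1) * d + (d + 1) * n) + s + 1) *
      (gaussSq K s n * (1 - X ^ (2 * n))) +
      (-1) ^ n * X ^ (n * ((s + 1) * d + (d + 1) * n) + (s + 2 * n + 2) * (d + 1)) *
      (gaussSq K s n * (1 - X ^ (2 * (s + n + 1))))) := by
    intro n
    have := gaussSq_mul_shift K s n
    rw [bTerm, bTerm, Nat.add_sub_cancel, Nat.sub_self]
    linear_combination (-1) ^ n * X ^ (n * ((s + 1) * d + (d + 1) * n)) *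
      (1 - X ^ ((s + 2 * n + 2) * (d + 1))) * this
  refine EqMod.of_mul_left (c := 1 + X ^ (s + 1)) (by simp) ?_
  unfold bSum
  have e : (1 + X ^ (s + 1)) * (qPoch K 1 s * ∑ n ∈ range M, bTerm K (d + 1) 1 s n) =
      qPoch K 1 s * ∑ n ∈ range M, (1 + X ^ (s + 1)) * bTerm K (d + 1) 1 s n := by
    rw [← Finset.mul_sum]
    ring
  rw [e, Finset.sum_congr rfl fun n _ => hl n, Finset.sum_add_distrib, mul_add,
    ← Finset.mul_sum, qPoch_succ]
  convert (EqMod.refl M _).add (key.mul_left (qPoch K 1 s)) using 1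
  simp only [Finset.sum_const_zero]
  ring

/-- As `s` grows, only the constant term of the deformed theta series survives. -/
theorem bSum_eqMod_qPoch {k i N : ℕ} (hk : 2 ≤ k) (hi : 1 ≤ i) (hik : i ≤ k) :
    EqMod N (bSum K N k i N) (qPoch K 1 N) := by
  unfold bSum
  rcases N with _ | N
  · simp [EqMod]
  conv => enter [3]; rw [← mul_one (qPoch K 1 (N + 1))]
  refine EqMod.mul_left _ ?_
  rw [Finset.sum_range_succ', ← zero_add (1 : K⟦X⟧)]
  refine EqMod.add ?_ ?_
  · rw [← Finset.sum_const_zero (s := range N)]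
    refine EqMod.sum fun n _ => ?_
    rw [bTerm, mul_assoc]
    refine X_pow_mul_eqMod_zero K ?_ _ _
    obtain ⟨d, rfl⟩ := Nat.exists_eq_add_of_le hik
    obtain ⟨j, rfl⟩ := Nat.exists_eq_add_of_le hi
    rw [show 1 + j + d - 1 = j + d by lia, Nat.add_sub_cancel_left]
    calc N + 1 ≤ (N + 1) * (j + d) := Nat.le_mul_of_pos_right _ (by lia)
      _ ≤ (N + 1) * (j + d) + (1 + j + d) * (n + 1) + d := by lia
      _ ≤ _ := Nat.le_mul_of_pos_left _ (Nat.succ_pos n)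
  · rw [bTerm, gaussSq_zero_right]
    simp only [pow_zero, zero_mul, one_mul, mul_zero, add_zero, mul_one]
    exact eqMod_one_sub_X_pow (by nlinarith)

end ThetaSum

/-! ### Admissible multisets of parts -/

/-- The difference and parity conditions in terms of multiplicities, with `c` in place of the
residue `i + k`: two adjacent values have together at most `k - 1` occurrences, and if they have
exactly that many, the sum of those occurrences has the parity of `c`. -/
def AdmissibleCounts (k c : ℕ) (m : Multiset ℕ) : Prop :=
  ∀ j, m.count j + m.count (j + 1) ≤ k - 1 ∧
    (m.count j + m.count (j + 1) = k - 1 → j * (k - 1) + m.count (j + 1) ≡ c [MOD 2])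

/-- The admissible multisets with all parts greater than `s`, of which fewer than `i` are equal to
`s + 1`. Lowering all parts by `s` changes the sum of `k - 1` parts by `s * (k - 1)`, which is why
this number enters the residue. -/
def shiftedAdmissible (k i s : ℕ) : Set (Multiset ℕ) :=
  {m | (∀ v ∈ m, s < v) ∧ m.count (s + 1) < i ∧ AdmissibleCounts k (i + 1 + s * (k - 1)) m}

theorem shiftedAdmissible_zero (k s : ℕ) : shiftedAdmissible k 0 s = ∅ := by
  ext m
  simp [shiftedAdmissible]

theorem zero_mem_shiftedAdmissible {k i : ℕ} (hk : 2 ≤ k) (hi : 1 ≤ i) (s : ℕ) :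
    0 ∈ shiftedAdmissible k i s := by
  refine ⟨by simp, by rwa [Multiset.count_zero], fun j => ⟨by simp, fun h => ?_⟩⟩
  simp at h
  lia

theorem count_eq_zero_of_forall_lt {m : Multiset ℕ} {s v : ℕ} (h : ∀ v ∈ m, s < v) (hv : v ≤ s) :
    m.count v = 0 :=
  Multiset.count_eq_zero_of_notMem fun hm => by have := h v hm; lia

theorem shiftedAdmissible_one (d s : ℕ) :
    shiftedAdmissible (d + 1) 1 s = shiftedAdmissible (d + 1) (d + 1) (s + 1) := by
  ext m
  have hc : 1 + 1 + s * (d + 1 - 1) ≡ d + 1 + 1 + (s + 1) * (d + 1 - 1) [MOD 2] := by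
    rw [add_mul, Nat.add_sub_cancel]
    unfold Nat.ModEq
    lia
  constructor
  · rintro ⟨h1, h2, h3⟩
    refine ⟨fun v hv => ?_, ?_, fun j => ⟨(h3 j).1, fun h => ((h3 j).2 h).trans hc⟩⟩
    · have h4 := h1 v hv
      have h5 : 0 < m.count v := Multiset.count_pos.2 hv
      rcases Nat.lt_or_eq_of_le h4 with h | h
      · exact h
      · subst h
        lia
    · have := (h3 (s + 1)).1
      lia
  · rintro ⟨h1, h2, h3⟩
    refine ⟨fun v hv => by have := h1 v hv; lia, ?_,
      fun j => ⟨(h3 j).1, fun h => ((h3 j).2 h).trans hc.symm⟩⟩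
    rw [count_eq_zero_of_forall_lt h1 le_rfl]
    exact one_pos

/-- For both values of `e`, adjoining `e` copies of `s + 1` imposes the same bound on
the multiplicity of `s + 2`: if `e = j`, the bound by the difference condition is weaker by one,
but equality in it is excluded by the parity condition. -/
theorem admissibleCounts_add_replicate {j d s e : ℕ} {m : Multiset ℕ} (hm : ∀ v ∈ m, s + 1 < v)
    (he : e = j ∨ e = j + 1) :
    AdmissibleCounts (j + 2 + d) (j + 2 + 1 + s * (j + 2 + d - 1))
        (m + Multiset.replicate e (s + 1)) ↔
      m.count (s + 1 + 1) < d + 1 ∧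
      AdmissibleCounts (j + 2 + d) (d + 1 + 1 + (s + 1) * (j + 2 + d - 1)) m := by
  have hk : j + 2 + d - 1 = j + 1 + d := by lia
  have hlow : ∀ v, v ≤ s + 1 → m.count v = 0 := fun v => count_eq_zero_of_forall_lt hm
  have hcount : ∀ v, (m + Multiset.replicate e (s + 1)).count v =
      m.count v + if s + 1 = v then e else 0 := fun v => by
    rw [Multiset.count_add, Multiset.count_replicate]
  have h1 := hlow (s + 1) le_rfl
  unfold AdmissibleCounts
  simp only [hcount, hk, add_mul s 1, one_mul]
  generalize hp : s * (j + 1 + d) = p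
  have hp1 : (s + 1) * (j + 1 + d) = p + (j + 1 + d) := by rw [← hp]; ring
  have hp2 : (s + 1 + 1) * (j + 1 + d) = p + 2 * (j + 1 + d) := by rw [← hp]; ring
  unfold Nat.ModEq
  constructor
  · intro h
    have a1 := h (s + 1)
    have a2 := h (s + 1 + 1)
    rw [hp1, if_pos rfl, if_neg (by lia), h1] at a1
    rw [hp2, if_neg (by lia), if_neg (by lia)] at a2
    refine ⟨?_, fun v => ?_⟩
    · rcases he with rfl | rfl <;> lia
    · rcases lt_trichotomy v (s + 1) with hv | rfl | hv
      · rw [hlow v hv.le, hlow (v + 1) hv]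
        lia
      · rw [hp1, h1]
        lia
      · have := h v
        rw [if_neg (by lia), if_neg (by lia)] at this
        lia
  · rintro ⟨hb, h⟩ v
    rcases lt_trichotomy v (s + 1) with hv | rfl | hv
    · rcases Nat.lt_or_eq_of_le (Nat.le_of_lt_succ hv) with hv' | rfl
      · rw [hlow v hv.le, hlow (v + 1) hv, if_neg (by lia), if_neg (by lia)]
        lia
      · rw [hlow v hv.le, h1, if_neg (by lia), if_pos rfl, hp]
        rcases he with rfl | rfl <;> lia
    · rw [hp1, h1, if_pos rfl, if_neg (by lia)]
      rcases he with rfl | rfl <;> lia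
    · have := h v
      rw [if_neg (by lia), if_neg (by lia)]
      lia

theorem add_replicate_mem_shiftedAdmissible {j d s e : ℕ} {m : Multiset ℕ}
    (hm : ∀ v ∈ m, s + 1 < v) (he : e = j ∨ e = j + 1) :
    m + Multiset.replicate e (s + 1) ∈ shiftedAdmissible (j + 2 + d) (j + 2) s ↔
      m ∈ shiftedAdmissible (j + 2 + d) (d + 1) (s + 1) := by
  have hcount : (m + Multiset.replicate e (s + 1)).count (s + 1) = e := by
    rw [Multiset.count_add, Multiset.count_replicate_self,
      count_eq_zero_of_forall_lt hm le_rfl, zero_add]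
  constructor
  · rintro ⟨-, -, h⟩
    exact ⟨hm, ((admissibleCounts_add_replicate hm he).1 h)⟩
  · rintro ⟨-, h⟩
    refine ⟨fun v hv => ?_, by lia, (admissibleCounts_add_replicate hm he).2 h⟩
    rcases Multiset.mem_add.1 hv with hv | hv
    · have := hm v hv
      lia
    · rw [Multiset.eq_of_mem_replicate hv]
      exact Nat.lt_succ_self s

/-- Sorting by the multiplicity of the smallest admitted part: at most `j - 1`, or `j`, or
`j + 1`. -/
theorem shiftedAdmissible_add_two (j d s : ℕ) :
    shiftedAdmissible (j + 2 + d) (j + 2) s = shiftedAdmissible (j + 2 + d) j s ∪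
      ((· + Multiset.replicate j (s + 1)) '' shiftedAdmissible (j + 2 + d) (d + 1) (s + 1) ∪
      (· + Multiset.replicate (j + 1) (s + 1)) ''
        shiftedAdmissible (j + 2 + d) (d + 1) (s + 1)) := by
  have hsmall : ∀ m : Multiset ℕ, m.count (s + 1) < j →
      (m ∈ shiftedAdmissible (j + 2 + d) (j + 2) s ↔ m ∈ shiftedAdmissible (j + 2 + d) j s) := by
    intro m hm
    have hc : j + 2 + 1 + s * (j + 2 + d - 1) ≡ j + 1 + s * (j + 2 + d - 1) [MOD 2] := by
      unfold Nat.ModEq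
      lia
    constructor
    · rintro ⟨h1, -, h3⟩
      exact ⟨h1, hm, fun v => ⟨(h3 v).1, fun h => ((h3 v).2 h).trans hc⟩⟩
    · rintro ⟨h1, -, h3⟩
      exact ⟨h1, by lia, fun v => ⟨(h3 v).1, fun h => ((h3 v).2 h).trans hc.symm⟩⟩
  ext m
  constructor
  · intro hm
    by_cases h : m.count (s + 1) < j
    · exact Or.inl ((hsmall m h).1 hm)
    right
    have hlt := hm.2.1
    have hsplit : m.filter (fun v => ¬ s + 1 = v) +
        Multiset.replicate (m.count (s + 1)) (s + 1) = m := by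
      rw [← Multiset.filter_eq, add_comm]
      exact Multiset.filter_add_not _ _
    have hpos : ∀ v ∈ m.filter (fun v => ¬ s + 1 = v), s + 1 < v := by
      intro v hv
      rw [Multiset.mem_filter] at hv
      have := hm.1 v hv.1
      lia
    have he : m.count (s + 1) = j ∨ m.count (s + 1) = j + 1 := by lia
    have hmem : m.filter (fun v => ¬ s + 1 = v) ∈
        shiftedAdmissible (j + 2 + d) (d + 1) (s + 1) := by
      rw [← add_replicate_mem_shiftedAdmissible hpos he, hsplit]
      exact hm
    rcases he with he | he
    · exact Or.inl ⟨_, hmem, by rw [← he]; exact hsplit⟩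
    · exact Or.inr ⟨_, hmem, by rw [← he]; exact hsplit⟩
  · rintro (hm | ⟨m, hm, rfl⟩ | ⟨m, hm, rfl⟩)
    · exact (hsmall m hm.2.1).2 hm
    · exact (add_replicate_mem_shiftedAdmissible hm.1 (Or.inl rfl)).2 hm
    · exact (add_replicate_mem_shiftedAdmissible hm.1 (Or.inr rfl)).2 hm

/-! ### Generating functions -/

section GenFun

variable (K : Type*) [Field K]

/-- The generating function of a set of multisets by the sum of the elements. Multisets containing
`0` are to be excluded: otherwise a coefficient may count an infinite set, as `0`. -/
noncomputable def genFun (S : Set (Multiset ℕ)) : K⟦X⟧ :=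
  PowerSeries.mk fun n => ((S ∩ {m | m.sum = n}).ncard : K)

theorem finite_inter_sum_eq {S : Set (Multiset ℕ)} (hS : ∀ m ∈ S, ∀ v ∈ m, 0 < v) (n : ℕ) :
    (S ∩ {m | m.sum = n}).Finite := by
  refine (Set.finite_range fun p : n.Partition => p.parts).subset ?_
  rintro m ⟨hm, hn⟩
  exact ⟨⟨m, fun {v} hv => hS m hm v hv, hn⟩, rfl⟩

theorem genFun_empty : genFun K ∅ = 0 := by
  ext n
  simp [genFun]

theorem genFun_union {S T : Set (Multiset ℕ)} (hS : ∀ m ∈ S, ∀ v ∈ m, 0 < v)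
    (hT : ∀ m ∈ T, ∀ v ∈ m, 0 < v) (h : Disjoint S T) :
    genFun K (S ∪ T) = genFun K S + genFun K T := by
  ext n
  simp only [genFun, coeff_mk, map_add]
  rw [Set.union_inter_distrib_right, Set.ncard_union_eq
    (h.mono Set.inter_subset_left Set.inter_subset_left)
    (finite_inter_sum_eq hS n) (finite_inter_sum_eq hT n), Nat.cast_add]

theorem genFun_add_replicate (S : Set (Multiset ℕ)) (e v : ℕ) :
    genFun K ((· + Multiset.replicate e v) '' S) = X ^ (e * v) * genFun K S := by
  ext n
  rw [coeff_X_pow_mul']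
  have hsum : ∀ m : Multiset ℕ, (m + Multiset.replicate e v).sum = m.sum + e * v := by simp
  simp only [genFun, coeff_mk]
  split_ifs with h
  · rw [← Set.ncard_image_of_injective (S ∩ {m | m.sum = n - e * v})
      (add_left_injective (Multiset.replicate e v))]
    congr 2
    apply Set.Subset.antisymm
    · rintro _ ⟨⟨m, hm, rfl⟩, hn⟩
      have hn : (m + Multiset.replicate e v).sum = n := hn
      rw [hsum] at hn
      exact ⟨m, ⟨hm, show m.sum = _ by lia⟩, rfl⟩
    · rintro _ ⟨m, ⟨hm, hn⟩, rfl⟩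
      have hn : m.sum = n - e * v := hn
      refine ⟨⟨m, hm, rfl⟩, ?_⟩
      change (m + Multiset.replicate e v).sum = n
      rw [hsum]
      lia
  · have : (· + Multiset.replicate e v) '' S ∩ {m | m.sum = n} = ∅ := by
      rw [Set.eq_empty_iff_forall_notMem]
      rintro _ ⟨⟨m, hm, rfl⟩, hn⟩
      have hn : (m + Multiset.replicate e v).sum = n := hn
      rw [hsum] at hn
      lia
    rw [this, Set.ncard_empty, Nat.cast_zero]

theorem pos_of_mem_shiftedAdmissible (k i s : ℕ) :
    ∀ m ∈ shiftedAdmissible k i s, ∀ v ∈ m, 0 < v :=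
  fun _ hm v hv => (Nat.zero_le s).trans_lt (hm.1 v hv)

theorem genFun_shiftedAdmissible_add_two (j d s : ℕ) :
    genFun K (shiftedAdmissible (j + 2 + d) (j + 2) s) =
      genFun K (shiftedAdmissible (j + 2 + d) j s) +
        (1 + X ^ (s + 1)) * X ^ ((s + 1) * j) *
          genFun K (shiftedAdmissible (j + 2 + d) (d + 1) (s + 1)) := by
  have hcount : ∀ e, ∀ m ∈ (· + Multiset.replicate e (s + 1)) ''
      shiftedAdmissible (j + 2 + d) (d + 1) (s + 1), m.count (s + 1) = e := by
    rintro e _ ⟨m, hm, rfl⟩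
    simp only [Multiset.count_add, Multiset.count_replicate_self,
      count_eq_zero_of_forall_lt hm.1 le_rfl, zero_add]
  have hpos := pos_of_mem_shiftedAdmissible (j + 2 + d) (j + 2) s
  rw [shiftedAdmissible_add_two] at hpos ⊢
  have hpos' := fun m hm => hpos m (Or.inr hm)
  rw [genFun_union K (fun m hm => hpos m (Or.inl hm)) hpos',
    genFun_union K (fun m hm => hpos' m (Or.inl hm)) (fun m hm => hpos' m (Or.inr hm)),
    genFun_add_replicate, genFun_add_replicate]
  · ring
  · rw [Set.disjoint_left]
    intro m h1 h2
    have h1 := hcount _ m h1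
    have h2 := hcount _ m h2
    lia
  · rw [Set.disjoint_left]
    rintro m h1 (h2 | h2)
    · have h1 := h1.2.1
      have h2 := hcount _ m h2
      lia
    · have h1 := h1.2.1
      have h2 := hcount _ m h2
      lia

/-- A nonempty multiset of parts greater than `s` has sum greater than `s`. -/
theorem genFun_shiftedAdmissible_eqMod_one {k i : ℕ} (hk : 2 ≤ k) (hi : 1 ≤ i) (s : ℕ) :
    EqMod s (genFun K (shiftedAdmissible k i s)) 1 := by
  rw [eqMod_iff_coeff]
  intro n hn
  have hzero : ∀ m ∈ shiftedAdmissible k i s, m.sum = n → m = 0 := by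
    intro m hm h
    refine Multiset.eq_zero_of_forall_notMem fun v hv => ?_
    have h1 := hm.1 v hv
    have h2 := Multiset.le_sum_of_mem hv
    lia
  rw [genFun, coeff_mk, coeff_one]
  split_ifs with h0
  · subst h0
    have : shiftedAdmissible k i s ∩ {m | m.sum = 0} = {0} := by
      ext m
      constructor
      · rintro ⟨hm, h⟩
        exact hzero m hm h
      · rintro rfl
        exact ⟨zero_mem_shiftedAdmissible hk hi s, Multiset.sum_zero⟩
    rw [this, Set.ncard_singleton, Nat.cast_one]
  · have : shiftedAdmissible k i s ∩ {m | m.sum = n} = ∅ := by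
      rw [Set.eq_empty_iff_forall_notMem]
      rintro m ⟨hm, h⟩
      have h : m.sum = n := h
      have := hzero m hm h
      subst this
      exact h0 h.symm
    rw [this, Set.ncard_empty, Nat.cast_zero]

/-- Both sides satisfy the same recursion, whose right-hand sides have larger `s` or smaller `i`,
and modulo `X ^ N` they agree for `s = N`. -/
theorem qPoch_mul_genFun_eqMod_bSum {k : ℕ} (hk : 2 ≤ k) (N t : ℕ) :
    ∀ s, s + t = N → ∀ i ≤ k,
      EqMod N (qPoch K 1 N * genFun K (shiftedAdmissible k i s)) (bSum K N k i s) := by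
  induction t with
  | zero =>
    rintro s rfl i hi
    rw [add_zero]
    rcases i with _ | i
    · rw [shiftedAdmissible_zero, genFun_empty, mul_zero, bSum_zero_index]
      exact EqMod.refl _ _
    · have h := (genFun_shiftedAdmissible_eqMod_one K hk (Nat.succ_pos i) s).mul_left (qPoch K 1 s)
      rw [mul_one] at h
      exact h.trans (bSum_eqMod_qPoch K hk (Nat.succ_pos i) hi).symm
  | succ t ih =>
    intro s hs i
    have ih := ih (s + 1) (by lia)
    induction i using Nat.twoStepInduction with
    | zero =>
      intro _
      rw [shiftedAdmissible_zero, genFun_empty, mul_zero, bSum_zero_index]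
      exact EqMod.refl _ _
    | one =>
      intro _
      obtain ⟨d, rfl⟩ := Nat.exists_eq_add_of_le' (show 1 ≤ k by lia)
      rw [shiftedAdmissible_one d s]
      exact (ih (d + 1) le_rfl).trans (bSum_one K N d s).symm
    | more j ihj _ =>
      intro hj
      obtain ⟨d, rfl⟩ := Nat.exists_eq_add_of_le hj
      refine EqMod.trans ?_ (bSum_add_two K N j d s).symm
      rw [genFun_shiftedAdmissible_add_two, mul_add, mul_left_comm]
      exact (ihj (by lia)).add ((ih (d + 1) (by lia)).mul_left _)

end GenFun

/-! ### Partitions and multiplicities -/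

section PartList

/-- The number of parts that are at least `v`. -/
def countGE {n : ℕ} (p : n.Partition) (v : ℕ) : ℕ :=
  (partList p).countP fun x => decide (v ≤ x)

theorem le_getD_iff_lt_countP {L : List ℕ} (hL : L.Pairwise (· ≥ ·)) (v : ℕ) {t : ℕ}
    (ht : t < L.length) :
    v ≤ L.getD t 0 ↔ t < L.countP fun x => decide (v ≤ x) := by
  induction L generalizing t with
  | nil => simp at ht
  | cons a L ih =>
    rw [List.pairwise_cons] at hL
    rw [List.countP_cons]
    by_cases hv : v ≤ a
    · rcases t with _ | t
      · simp [hv]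
      · have := ih hL.2 (t := t) (by simpa using ht)
        simp [hv] at this ⊢
        exact this
    · have h0 : (L.countP fun x => decide (v ≤ x)) = 0 := by
        rw [List.countP_eq_zero]
        intro x hx
        have := hL.1 x hx
        simp
        lia
      rcases t with _ | t
      · simp [hv, h0]
      · have := ih hL.2 (t := t) (by simpa using ht)
        rw [h0] at this ⊢
        simp [hv] at this ⊢
        exact this

theorem countP_le_eq_add_count (L : List ℕ) (v : ℕ) :
    (L.countP fun x => decide (v ≤ x)) = (L.countP fun x => decide (v + 1 ≤ x)) + L.count v := by
  induction L with
  | nil => simp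
  | cons a L ih =>
    rw [List.countP_cons, List.countP_cons, List.count_cons, ih]
    simp only [decide_eq_true_eq, beq_iff_eq]
    split_ifs <;> lia

variable {n : ℕ} (p : n.Partition)

theorem le_part_iff (v : ℕ) {t : ℕ} (ht : t < length p) : v ≤ part p t ↔ t < countGE p v :=
  le_getD_iff_lt_countP (Multiset.pairwise_sort _ _) v ht

theorem countGE_eq (v : ℕ) : countGE p v = countGE p (v + 1) + p.parts.count v := by
  have : p.parts.count v = (partList p).count v := by
    conv_lhs => rw [← Multiset.sort_eq p.parts (· ≥ ·)]
    exact Multiset.coe_count _ _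
  rw [this]
  exact countP_le_eq_add_count _ v

theorem countGE_le_length (v : ℕ) : countGE p v ≤ length p :=
  List.countP_le_length

theorem countGE_sub_two (j : ℕ) :
    countGE p j = countGE p (j + 2) + (p.parts.count j + p.parts.count (j + 1)) := by
  rw [countGE_eq p j, countGE_eq p (j + 1)]
  ring

theorem difference_iff (k : ℕ) :
    (∀ t, t + (k - 1) < length p → part p (t + (k - 1)) + 2 ≤ part p t) ↔
      ∀ j, p.parts.count j + p.parts.count (j + 1) ≤ k - 1 := by
  constructor
  · intro h j
    by_contra! hj
    have hN := countGE_sub_two p j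
    have hle := countGE_le_length p j
    have h1 := h (countGE p (j + 2)) (by lia)
    have h2 := (le_part_iff p j (t := countGE p (j + 2) + (k - 1)) (by lia)).2 (by lia)
    have h3 := (le_part_iff p (j + 2) (t := countGE p (j + 2)) (by lia)).1 (by lia)
    lia
  · intro h t ht
    have hj := h (part p (t + (k - 1)))
    have hN := countGE_sub_two p (part p (t + (k - 1)))
    have h1 := (le_part_iff p _ ht).1 le_rfl
    rw [le_part_iff p _ (by lia)]
    lia

/-- The parts equal to `j` or `j + 1` have the indices from `countGE p (j + 2)` on, those equal to
`j + 1` first. -/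
theorem sum_part_eq {k j : ℕ} (h : p.parts.count j + p.parts.count (j + 1) = k - 1) :
    ∑ r ∈ range (k - 1), part p (countGE p (j + 2) + r) =
      j * (k - 1) + p.parts.count (j + 1) := by
  have h0 := countGE_sub_two p j
  have h1 := countGE_eq p (j + 1)
  have hle := countGE_le_length p j
  have hhigh : ∀ r ∈ range (p.parts.count (j + 1)), part p (countGE p (j + 2) + r) = j + 1 := by
    intro r hr
    rw [Finset.mem_range] at hr
    have a1 := le_part_iff p (j + 1) (t := countGE p (j + 2) + r) (by lia)
    have a2 := le_part_iff p (j + 2) (t := countGE p (j + 2) + r) (by lia)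
    rw [h1] at a1
    lia
  have hlow : ∀ r ∈ range (p.parts.count j),
      part p (countGE p (j + 2) + (p.parts.count (j + 1) + r)) = j := by
    intro r hr
    rw [Finset.mem_range] at hr
    have a1 := le_part_iff p j
      (t := countGE p (j + 2) + (p.parts.count (j + 1) + r)) (by lia)
    have a2 := le_part_iff p (j + 1)
      (t := countGE p (j + 2) + (p.parts.count (j + 1) + r)) (by lia)
    rw [h1] at a2
    lia
  rw [← h, add_comm (p.parts.count j), Finset.sum_range_add, Finset.sum_congr rfl hhigh,
    Finset.sum_congr rfl hlow]
  simp only [Finset.sum_const, Finset.card_range, smul_eq_mul]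
  ring

/-- In the presence of the difference condition, `k - 1` consecutive parts differing by at most `1`
are all the parts equal to `j` or `j + 1`, for some `j`. -/
theorem parity_iff {k c : ℕ} (hk : 2 ≤ k)
    (hd : ∀ j, p.parts.count j + p.parts.count (j + 1) ≤ k - 1) :
    (∀ t, t + (k - 2) < length p → part p t ≤ part p (t + (k - 2)) + 1 →
        (∑ j ∈ range (k - 1), part p (t + j)) ≡ c [MOD 2]) ↔
      ∀ j, p.parts.count j + p.parts.count (j + 1) = k - 1 →
        j * (k - 1) + p.parts.count (j + 1) ≡ c [MOD 2] := by
  constructor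
  · intro h j hj
    have hN := countGE_sub_two p j
    have hle := countGE_le_length p j
    rw [← sum_part_eq p hj]
    refine h _ (by lia) ?_
    have h2 := (le_part_iff p j (t := countGE p (j + 2) + (k - 2)) (by lia)).2 (by lia)
    have h3 := (le_part_iff p (j + 2) (t := countGE p (j + 2)) (by lia))
    lia
  · intro h t ht hp
    have hN := countGE_sub_two p (part p (t + (k - 2)))
    have hj := hd (part p (t + (k - 2)))
    have h1 := (le_part_iff p _ ht).1 le_rfl
    have h2 := le_part_iff p (part p (t + (k - 2)) + 2) (t := t) (by lia)
    have hc : p.parts.count (part p (t + (k - 2))) +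
        p.parts.count (part p (t + (k - 2)) + 1) = k - 1 := by lia
    have ht' : t = countGE p (part p (t + (k - 2)) + 2) := by lia
    have h3 := sum_part_eq p hc
    rw [← ht'] at h3
    rw [h3]
    exact h _ hc

theorem isAdmissible_iff {k i : ℕ} (hk : 2 ≤ k) (hik : i ≤ k) :
    IsAdmissible k i p ↔ p.parts ∈ shiftedAdmissible k (k - i + 1) 0 := by
  have hc : i + k ≡ k - i + 1 + 1 + 0 * (k - 1) [MOD 2] := by
    unfold Nat.ModEq
    lia
  constructor
  · rintro ⟨h1, h2, h3⟩
    rw [difference_iff p k] at h1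
    rw [parity_iff p hk h1] at h3
    exact ⟨fun v hv => p.parts_pos hv, Nat.lt_succ_of_le h2,
      fun j => ⟨h1 j, fun h => (h3 j h).trans hc⟩⟩
  · rintro ⟨-, h2, h3⟩
    have h1 := fun j => (h3 j).1
    exact ⟨(difference_iff p k).2 h1, Nat.le_of_lt_succ h2,
      (parity_iff p hk h1).2 fun j h => ((h3 j).2 h).trans hc.symm⟩

end PartList

theorem b_eq_ncard {k i : ℕ} (hk : 2 ≤ k) (hik : i ≤ k) (n : ℕ) :
    b k i n = (shiftedAdmissible k (k - i + 1) 0 ∩ {m | m.sum = n}).ncard := by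
  have hinj : Function.Injective fun p : n.Partition => p.parts :=
    fun _ _ h => Nat.Partition.ext h
  have h : shiftedAdmissible k (k - i + 1) 0 ∩ {m | m.sum = n} =
      (fun p : n.Partition => p.parts) '' {p | IsAdmissible k i p} := by
    ext m
    constructor
    · rintro ⟨hm, hn⟩
      refine ⟨⟨m, fun {v} hv => hm.1 v hv, hn⟩, ?_, rfl⟩
      exact (isAdmissible_iff _ hk hik).2 hm
    · rintro ⟨p, hp, rfl⟩
      exact ⟨(isAdmissible_iff p hk hik).1 hp, p.parts_sum⟩
  rw [h, Set.ncard_image_of_injective _ hinj]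
  exact Nat.card_coe_set_eq _

/-! ### The product formula -/

section Product

variable (K : Type*) [Field K]

theorem numFactor_eq {k i : ℕ} (hi : 1 ≤ i) (hik : i ≤ k) (j : ℕ) :
    numFactor K k i j = (1 - X ^ (2 * ((k - i + 1) + (i - 1)) * (j + 1))) *
      (1 - X ^ (2 * ((k - i + 1) + (i - 1)) * j + (k - i + 1) + 2 * (i - 1))) *
      (1 - X ^ (2 * ((k - i + 1) + (i - 1)) * j + (k - i + 1))) := by
  obtain ⟨d, rfl⟩ := Nat.exists_eq_add_of_le' hi
  obtain ⟨e, rfl⟩ := Nat.exists_eq_add_of_le hik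
  have h : 2 * (d + 1 + e) * (j + 1) = 2 * (d + 1 + e) * j + 2 * (d + 1 + e) := by ring
  have h0 : d + 1 + e - (d + 1) + 1 = e + 1 := by lia
  have h1 : e + 1 + (d + 1 - 1) = d + 1 + e := by lia
  rw [numFactor, h0, h1, h]
  generalize 2 * (d + 1 + e) * j = y
  rw [show y + 2 * (d + 1 + e) - (d + 1 + e) + (d + 1) - 1 = y + (e + 1) + 2 * (d + 1 - 1) by lia,
    show y + 2 * (d + 1 + e) - (d + 1 + e) - (d + 1) + 1 = y + (e + 1) by lia]

theorem numFactor_eqMod_one {k i : ℕ} (hi : 1 ≤ i) (hik : i ≤ k) (j : ℕ) :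
    EqMod (j + 1) (numFactor K k i j) 1 := by
  have hj : j ≤ 2 * ((k - i + 1) + (i - 1)) * j := Nat.le_mul_of_pos_left j (by lia)
  have hj' : j + 1 ≤ 2 * ((k - i + 1) + (i - 1)) * (j + 1) :=
    Nat.le_mul_of_pos_left (j + 1) (by lia)
  rw [numFactor_eq K hi hik]
  simpa only [mul_one] using ((eqMod_one_sub_X_pow (K := K) hj').mul
    (eqMod_one_sub_X_pow (by lia))).mul (eqMod_one_sub_X_pow (by lia))

theorem qFactor_eqMod_one (j : ℕ) : EqMod (j + 1) (qFactor K j) 1 :=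
  eqMod_one_sub_X_pow le_rfl

theorem prod_qFactor (N : ℕ) : ∏ j ∈ range N, qFactor K j = qPoch K 1 N := by
  simp [qPoch, qFactor]

theorem prod_numFactor_eqMod {k i : ℕ} (hk : 2 ≤ k) (hi : 1 ≤ i) (hik : i ≤ k) (N : ℕ) :
    EqMod N (qPoch K 1 N * PowerSeries.mk fun n => (b k i n : K))
      (∏ j ∈ range N, numFactor K k i j) := by
  have hb : (PowerSeries.mk fun n => (b k i n : K)) =
      genFun K (shiftedAdmissible k (k - i + 1) 0) := by
    ext n
    rw [coeff_mk, genFun, coeff_mk, b_eq_ncard hk hik]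
  have h := qPoch_mul_genFun_eqMod_bSum K hk N N 0 (zero_add N) (k - i + 1) (by lia)
  have ht := sum_thetaTerm_eqMod K (k - i + 1) (i - 1) (Nat.succ_pos _) N
  rw [hb, Finset.prod_congr rfl fun j _ => numFactor_eq K hi hik j]
  refine h.trans ?_
  convert ht using 1
  rw [bSum, qPoch, Finset.prod_range_zero, one_mul]
  refine Finset.sum_congr rfl fun n _ => ?_
  rw [← bTerm_zero_left, show k - i + 1 + (i - 1) = k by lia]

end Product

end AndrewsBressoud

theorem mainTheorem1 (K : Type*) [Field K] [TopologicalSpace K] [T2Space K]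
    (k : ℕ) (hk : 2 ≤ k) (i : ℕ) (hi : 1 ≤ i) (hik : i ≤ k) :
    Multipliable (AndrewsBressoud.numFactor K k i) ∧
    Multipliable (AndrewsBressoud.qFactor K) ∧
    AndrewsBressoud.B K k i =
      PowerSeries.mk (fun n => (AndrewsBressoud.b k i n : K)) := by
  open AndrewsBressoud PowerSeries in
  refine ⟨(hasProd_of_eqMod_one (numFactor_eqMod_one K hi hik)).multipliable,
    (hasProd_of_eqMod_one (qFactor_eqMod_one K)).multipliable, ?_⟩
  have hq : ∀ N, EqMod N (qInf K) (qPoch K 1 N) := fun N => by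
    rw [← prod_qFactor]
    exact tprod_eqMod_prod_range (qFactor_eqMod_one K) N
  have hc : constantCoeff (qInf K) ≠ 0 := by
    have := (hq 1).coeff_eq one_pos
    rw [coeff_zero_eq_constantCoeff_apply, coeff_zero_eq_constantCoeff_apply,
      constantCoeff_qPoch K one_pos] at this
    rw [this]
    exact one_ne_zero
  have key : ∏' j, numFactor K k i j = (PowerSeries.mk fun n => (b k i n : K)) * qInf K := by
    refine eq_of_forall_eqMod fun N => ?_
    refine (tprod_eqMod_prod_range (numFactor_eqMod_one K hi hik) N).trans ?_
    refine (prod_numFactor_eqMod K hk hi hik N).symm.trans ?_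
    rw [mul_comm]
    exact (hq N).symm.mul_left _
  rw [B, key, mul_assoc, PowerSeries.mul_inv_cancel _ hc, mul_one]
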